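/- Let $\mathfrak{g}$ be a finite-dimensional reductive Lie algebra over $\mathbb{C}$ (i.e. its radical equals its center), and let $\mathfrak{g}[t]=\mathfrak{g}\otimes\mathbb{C}[t]$ be its current algebra, with bracket $[x(P),y(Q)]=[x,y](PQ)$, where $x(P):=x\otimes P$. Let $V_1=V(\lambda_1),\dots,V_d=V(\lambda_d)$ be finite-dimensional irreducible $\mathfrak{g}$-modules (with highest weights $\lambda_1,\dots,\lambda_d$, which may be arbitrary dominant integral weights), and let $p_1,\dots,p_d\in\mathbb{C}$ be distinct. Let $W=V_1\otimes\cdots\otimes V_d$ be the tensor product $\mathfrak{g}$-module, and let $\mathfrak{g}[t]$ (hence its enveloping algebra $U(\mathfrak{g}[t])$) act on $W$ by $$x(P)\cdot(v_1\otimes\cdots\otimes v_d)=\sum_{i=1}^d P(p_i)\,v_1\otimes\cdots\otimes x\cdot v_i\otimes\cdots\otimes v_d .$$ Let $[U(\mathfrak{g}[t])]^{\mathfrak{g}}$ be the algebra of elements of $U(\mathfrak{g}[t])$ that commute with $\mathfrak{g}=\mathfrak{g}\otimes 1$. For an irreducible $\mathfrak{g}$-module $S=V(\mu)$, let $W[\mu]$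 be the corresponding isotypic component, i.e. the sum of all $\mathfrak{g}$-submodules of $W$ isomorphic to $S$. Then each nonzero isotypic component $W[\mu]$ is an irreducible module for $\mathfrak{g}\times[U(\mathfrak{g}[t])]^{\mathfrak{g}}$: it is stable under $[U(\mathfrak{g}[t])]^{\mathfrak{g}}$, the actions of $\mathfrak{g}$ and of $[U(\mathfrak{g}[t])]^{\mathfrak{g}}$ on it commute, and the only subspaces of $W[\mu]$ stable under both $\mathfrak{g}$ and $[U(\mathfrak{g}[t])]^{\mathfrak{g}}$ are $0$ and $W[\mu]$. -/

import Mathlib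

open scoped TensorProduct Polynomial

namespace CurrentAlgebra

noncomputable section

attribute [local instance 100] LieRing.ofAssociativeRing

/-- The endomorphism `v₁ ⊗ ⋯ ⊗ v_d ↦ v₁ ⊗ ⋯ ⊗ f vᵢ ⊗ ⋯ ⊗ v_d` of a tensor product,
as a linear function of the endomorphism `f` of the `i`-th factor. -/
def actOnFactor {R : Type*} [CommRing R] {ι : Type*} [DecidableEq ι]
    {V : ι → Type*} [∀ i, AddCommGroup (V i)] [∀ i, Module R (V i)] (i : ι) :
    Module.End R (V i) →ₗ[R] Module.End R (⨂[R] j, V j) where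
  toFun f := PiTensorProduct.map (Function.update (fun _ => LinearMap.id) i f)
  map_add' f g := PiTensorProduct.map_update_add _ i f g
  map_smul' c f := PiTensorProduct.map_update_smul _ i c f

theorem actOnFactor_tprod {R : Type*} [CommRing R] {ι : Type*} [DecidableEq ι]
    {V : ι → Type*} [∀ i, AddCommGroup (V i)] [∀ i, Module R (V i)] (i : ι)
    (f : Module.End R (V i)) (v : ∀ j, V j) :
    actOnFactor i f (PiTensorProduct.tprod R v)
      = PiTensorProduct.tprod R (Function.update v i (f (v i))) := by
  simp only [actOnFactor, LinearMap.coe_mk, AddHom.coe_mk, PiTensorProduct.map_tprod]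
  congr 1
  funext j
  by_cases h : j = i
  · subst h; simp
  · simp [h]

theorem actOnFactor_lie {R : Type*} [CommRing R] {ι : Type*} [DecidableEq ι]
    {V : ι → Type*} [∀ i, AddCommGroup (V i)] [∀ i, Module R (V i)] (i j : ι)
    (f : Module.End R (V i)) (g : Module.End R (V j)) (hij : i ≠ j) :
    ⁅actOnFactor i f, actOnFactor j g⁆ = 0 := by
  rw [Ring.lie_def, sub_eq_zero]
  apply PiTensorProduct.ext
  ext v
  simp only [LinearMap.compMultilinearMap_apply, Module.End.mul_apply, actOnFactor_tprod,
    Function.update_of_ne hij, Function.update_of_ne hij.symm]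
  rw [Function.update_comm hij]

theorem actOnFactor_lie_same {R : Type*} [CommRing R] {ι : Type*} [DecidableEq ι]
    {V : ι → Type*} [∀ i, AddCommGroup (V i)] [∀ i, Module R (V i)] (i : ι)
    (f g : Module.End R (V i)) :
    ⁅actOnFactor i f, actOnFactor i g⁆ = actOnFactor i ⁅f, g⁆ := by
  rw [Ring.lie_def, Ring.lie_def, map_sub]
  congr 1 <;>
  · apply PiTensorProduct.ext
    ext v
    simp [actOnFactor_tprod, Module.End.mul_apply]

/-- The tensor product `x ↦ ∑ i, 1 ⊗ ⋯ ⊗ ρᵢ(x) ⊗ ⋯ ⊗ 1` of finitely many representations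
`ρᵢ : L → End (V i)` of a Lie algebra `L`. -/
def tensorRep {R : Type*} [CommRing R] {L : Type*} [LieRing L] [LieAlgebra R L]
    {ι : Type*} [Fintype ι] [DecidableEq ι] {V : ι → Type*} [∀ i, AddCommGroup (V i)]
    [∀ i, Module R (V i)] (ρ : ∀ i, L →ₗ⁅R⁆ Module.End R (V i)) :
    L →ₗ⁅R⁆ Module.End R (⨂[R] i, V i) where
  toLinearMap := ∑ i, actOnFactor i ∘ₗ (ρ i : L →ₗ[R] Module.End R (V i))
  map_lie' {x y} := by
    simp only [AddHom.toFun_eq_coe, LinearMap.coe_toAddHom, LinearMap.sum_apply,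
      LinearMap.comp_apply, LieHom.coe_toLinearMap, LieHom.map_lie]
    rw [sum_lie]
    refine Finset.sum_congr rfl fun i _ => ?_
    rw [lie_sum, Finset.sum_eq_single i, actOnFactor_lie_same]
    · intro j _ hj
      exact actOnFactor_lie i j _ _ hj.symm
    · simp

/-- The tensor product of a finite family of Lie modules is a Lie module. -/
instance instLieRingModulePiTensor {R : Type*} [CommRing R] {L : Type*} [LieRing L]
    [LieAlgebra R L] {ι : Type*} [Fintype ι] [DecidableEq ι] {V : ι → Type*}
    [∀ i, AddCommGroup (V i)] [∀ i, Module R (V i)] [∀ i, LieRingModule L (V i)]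
    [∀ i, LieModule R L (V i)] : LieRingModule L (⨂[R] i, V i) :=
  LieRingModule.compLieHom _ (tensorRep fun i => LieModule.toEnd R L (V i))

instance instLieModulePiTensor {R : Type*} [CommRing R] {L : Type*} [LieRing L]
    [LieAlgebra R L] {ι : Type*} [Fintype ι] [DecidableEq ι] {V : ι → Type*}
    [∀ i, AddCommGroup (V i)] [∀ i, Module R (V i)] [∀ i, LieRingModule L (V i)]
    [∀ i, LieModule R L (V i)] : LieModule R L (⨂[R] i, V i) :=
  LieModule.compLieHom _ (tensorRep fun i => LieModule.toEnd R L (V i))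

/-- The current algebra `𝔤[t] = ℂ[t] ⊗ 𝔤`, with bracket `[x(P), y(Q)] = [x, y](PQ)`, where
`x(P)` is `P ⊗ x`. -/
abbrev Current (𝔤 : Type*) [LieRing 𝔤] [LieAlgebra ℂ 𝔤] : Type _ := ℂ[X] ⊗[ℂ] 𝔤

/-- Evaluation at a point: the Lie algebra morphism `𝔤[t] → 𝔤`, `x(P) ↦ P(z) x`. -/
def evalAt (𝔤 : Type*) [LieRing 𝔤] [LieAlgebra ℂ 𝔤] (z : ℂ) : Current 𝔤 →ₗ⁅ℂ⁆ 𝔤 where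
  toLinearMap := TensorProduct.lift
    ((LinearMap.lsmul ℂ 𝔤 : ℂ →ₗ[ℂ] 𝔤 →ₗ[ℂ] 𝔤) ∘ₗ (Polynomial.aeval z).toLinearMap)
  map_lie' {a b} := by
    simp only [AddHom.toFun_eq_coe, LinearMap.coe_toAddHom]
    induction a using TensorProduct.induction_on with
    | zero => simp
    | add a₁ a₂ h₁ h₂ => rw [add_lie, map_add, h₁, h₂, map_add, add_lie]
    | tmul P x =>
      induction b using TensorProduct.induction_on with
      | zero => simp
      | add b₁ b₂ h₁ h₂ => rw [lie_add, map_add, h₁, h₂, map_add, lie_add]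
      | tmul Q y =>
        simp [mul_smul, smul_comm (Polynomial.eval z Q)]

/-- The evaluation module: the action of `𝔤[t]` on `V₁ ⊗ ⋯ ⊗ V_d` at the points `p₁, …, p_d`,
`x(P) ↦ ∑ i, P(pᵢ) (1 ⊗ ⋯ ⊗ x ⊗ ⋯ ⊗ 1)`. -/
def evalRep {𝔤 : Type*} [LieRing 𝔤] [LieAlgebra ℂ 𝔤] {ι : Type*} [Fintype ι] [DecidableEq ι]
    (V : ι → Type*) [∀ i, AddCommGroup (V i)] [∀ i, Module ℂ (V i)]
    [∀ i, LieRingModule 𝔤 (V i)] [∀ i, LieModule ℂ 𝔤 (V i)] (p : ι → ℂ) :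
    Current 𝔤 →ₗ⁅ℂ⁆ Module.End ℂ (⨂[ℂ] i, V i) :=
  tensorRep fun i => (LieModule.toEnd ℂ 𝔤 (V i)).comp (evalAt 𝔤 (p i))

theorem evalRep_tprod {𝔤 : Type*} [LieRing 𝔤] [LieAlgebra ℂ 𝔤] {ι : Type*} [Fintype ι]
    [DecidableEq ι] (V : ι → Type*) [∀ i, AddCommGroup (V i)] [∀ i, Module ℂ (V i)]
    [∀ i, LieRingModule 𝔤 (V i)] [∀ i, LieModule ℂ 𝔤 (V i)] (p : ι → ℂ)
    (P : ℂ[X]) (x : 𝔤) (v : ∀ i, V i) :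
    evalRep V p (P ⊗ₜ x) (PiTensorProduct.tprod ℂ v) =
      ∑ i, P.eval (p i) • PiTensorProduct.tprod ℂ (Function.update v i ⁅x, v i⁆) := by
  change (∑ i, actOnFactor i ∘ₗ _ : _ →ₗ[ℂ] _) _ _ = _
  simp only [LinearMap.sum_apply, LinearMap.comp_apply, actOnFactor_tprod]
  refine Finset.sum_congr rfl fun i _ => ?_
  rw [← MultilinearMap.map_update_smul, ← smul_lie]
  simp [evalAt]

theorem lie_tprod {𝔤 : Type*} [LieRing 𝔤] [LieAlgebra ℂ 𝔤] {ι : Type*} [Fintype ι]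
    [DecidableEq ι] (V : ι → Type*) [∀ i, AddCommGroup (V i)] [∀ i, Module ℂ (V i)]
    [∀ i, LieRingModule 𝔤 (V i)] [∀ i, LieModule ℂ 𝔤 (V i)] (x : 𝔤) (v : ∀ i, V i) :
    ⁅x, PiTensorProduct.tprod ℂ v⁆ =
      ∑ i, PiTensorProduct.tprod ℂ (Function.update v i ⁅x, v i⁆) := by
  change (∑ i, actOnFactor i ∘ₗ _ : _ →ₗ[ℂ] _) _ _ = _
  simp [LinearMap.sum_apply, LinearMap.comp_apply, actOnFactor_tprod]

/-- The invariants `[U(𝔤[t])]^𝔤` of the enveloping algebra of `𝔤[t]` under the adjoint action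
of the subalgebra `𝔤 = 1 ⊗ 𝔤` of constant currents. -/
def invariants (𝔤 : Type*) [LieRing 𝔤] [LieAlgebra ℂ 𝔤] :
    Subalgebra ℂ (UniversalEnvelopingAlgebra ℂ (Current 𝔤)) where
  carrier := {u | ∀ x : 𝔤, ⁅UniversalEnvelopingAlgebra.ι ℂ ((1 : ℂ[X]) ⊗ₜ[ℂ] x), u⁆ = 0}
  mul_mem' {a b} ha hb x := by
    have h₁ := sub_eq_zero.mp ((Ring.lie_def _ _).symm.trans (ha x))
    have h₂ := sub_eq_zero.mp ((Ring.lie_def _ _).symm.trans (hb x))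
    rw [Ring.lie_def, sub_eq_zero, ← mul_assoc, h₁, mul_assoc, h₂, mul_assoc]
  add_mem' {a b} ha hb x := by rw [lie_add, ha x, hb x, add_zero]
  algebraMap_mem' c x := by
    rw [Ring.lie_def, sub_eq_zero]
    exact (Algebra.commutes c _).symm

/-- The action of `[U(𝔤[t])]^𝔤` on the evaluation module. -/
def invariantsAction (𝔤 : Type*) [LieRing 𝔤] [LieAlgebra ℂ 𝔤] {ι : Type*} [Fintype ι]
    [DecidableEq ι] (V : ι → Type*) [∀ i, AddCommGroup (V i)] [∀ i, Module ℂ (V i)]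
    [∀ i, LieRingModule 𝔤 (V i)] [∀ i, LieModule ℂ 𝔤 (V i)] (p : ι → ℂ) :
    invariants 𝔤 →ₐ[ℂ] Module.End ℂ (⨂[ℂ] i, V i) :=
  (UniversalEnvelopingAlgebra.lift ℂ (evalRep V p)).comp (invariants 𝔤).val

/-- The isotypic component of type `S` of a Lie module `M`: the sum of all Lie submodules of `M`
that are isomorphic to `S`. -/
def isotypicComponent (R L M S : Type*) [CommRing R] [LieRing L] [LieAlgebra R L]
    [AddCommGroup M] [Module R M] [LieRingModule L M] [LieModule R L M]
    [AddCommGroup S] [Module R S] [LieRingModule L S] [LieModule R L S] : LieSubmodule R L M :=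
  sSup {N | Nonempty (N ≃ₗ⁅R,L⁆ S)}

/-- Let a Lie algebra `L` act on `M`, and let an associative algebra `A` act on `M` through `φ`.
The Lie submodule `C` of `M` is an irreducible module for `L × A`: it is stable under `A`, the two
actions on `C` commute, `C` is nonzero, and `C` has no proper nonzero subspace that is stable
under both `L` and `A`. -/
structure IsIrreducibleJoint {R L M A : Type*} [CommRing R] [LieRing L] [LieAlgebra R L]
    [AddCommGroup M] [Module R M] [LieRingModule L M] [LieModule R L M] [Ring A] [Algebra R A]
    (φ : A →ₐ[R] Module.End R M) (C : LieSubmodule R L M) : Prop where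
  stable : ∀ a : A, ∀ m ∈ C, φ a m ∈ C
  commute : ∀ (x : L) (a : A), ∀ m ∈ C, ⁅x, φ a m⁆ = φ a ⁅x, m⁆
  ne_bot : C ≠ ⊥
  eq_bot_or_eq : ∀ N : LieSubmodule R L M, N ≤ C → (∀ a : A, ∀ m ∈ N, φ a m ∈ N) →
    N = ⊥ ∨ N = C

end

end CurrentAlgebra

/-!
Write `U = U(𝔤[t])`, `W = V₁ ⊗ ⋯ ⊗ V_d` and `π : U → End W` for the action. Two facts carry the
proof.

* `π` is surjective (`lift_evalRep_surjective`). By Lagrange interpolation at the distinct points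
  `pᵢ`, the image of `π` contains the action of each `x ∈ 𝔤` on a single tensor factor; by
  Burnside's theorem on the irreducible `Vᵢ` it then contains `End Vᵢ` acting on the `i`-th factor
  for every `i`, and these generate `End W`.
* Taking `𝔤`-invariants is exact enough (`exists_invariant_sub_mem`): if the centre of `𝔤` acts by
  zero on a finite-dimensional module `M`, then every vector of `M` is congruent to an invariant one
  modulo any subspace containing `𝔤 M`. This is the part of Weyl's complete reducibility theorem
  that is needed. It is
  proved for `𝔤 / Z(𝔤)`, which has trivial radical, by induction on `dim M`: a Casimir operator `c`
  is not nilpotent when the action is nonzero, it commutes with the action, and its image lies in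
  `𝔤 M`, so the Fitting decomposition of `c` reduces the claim to the smaller module `ker cᵏ`.

Together they show that every `𝔤`-equivariant map from a submodule `N` of `W` to `W` is the
restriction of the action of some element of `U^𝔤` (`exists_invariantsAction_eq`): extend the map
linearly to `W`, lift it along `π` to `u ∈ U`, and correct `u` by an element that kills `N`. The
correction takes place in a finite-dimensional submodule of `U`, as the adjoint action of `𝔤` on
`U` is locally finite and the centre of `𝔤` acts on it by zero.

Now let `N ≠ 0` be a stable submodule of the isotypic component of type `S`. It contains a simple
submodule, which is isomorphic to `S` (`nonempty_equiv_of_isAtom_of_le`); an isomorphism from it to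
any other copy of `S` in `W` is realised by an invariant, so `N` contains every copy of `S`.
-/

namespace CurrentAlgebra

/-! ### Casimir operators and invariants of modules with trivial central action -/

section Weyl

open LieAlgebra LieModule Module

attribute [local instance 100] LieRing.ofAssociativeRing

/-- For a nondegenerate symmetric form, the tensor `∑ i, bᵢ ⊗ bⁱ` of dual bases is annihilated by
every skew endomorphism `T`; here its image under `x ⊗ y ↦ f x * f y`. -/
theorem sum_dualBasis_skew {K V A ι : Type*} [Field K] [AddCommGroup V] [Module K V]
    [Fintype ι] [DecidableEq ι] [Ring A] [Algebra K A]
    {B : LinearMap.BilinForm K V} (hB : B.Nondegenerate) (hs : B.IsSymm) (b : Basis ι K V)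
    (T : V →ₗ[K] V) (hT : ∀ x y, B (T x) y = -B x (T y)) (f : V →ₗ[K] A) :
    ∑ i, (f (T (b i)) * f (B.dualBasis hB b i) + f (b i) * f (T (B.dualBasis hB b i))) = 0 := by
  have h1 (v : V) : v = ∑ j, B v (b j) • B.dualBasis hB b j := by
    conv_lhs => rw [← (B.dualBasis hB b).sum_repr v]
    simp
  have h2 (v : V) : v = ∑ j, B v (B.dualBasis hB b j) • b j := by
    conv_lhs => rw [← b.sum_repr v]
    refine Finset.sum_congr rfl fun j _ => ?_
    have := LinearMap.BilinForm.dualBasis_repr_apply hB (B.dualBasis hB b) v j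
    rw [LinearMap.BilinForm.dualBasis_dualBasis hB hs] at this
    rw [this]
  rw [Finset.sum_add_distrib]
  have e1 : ∀ i, f (T (b i)) * f (B.dualBasis hB b i)
      = ∑ j, B (T (b i)) (B.dualBasis hB b j) • (f (b j) * f (B.dualBasis hB b i)) := by
    intro i
    conv_lhs => rw [h2 (T (b i))]
    simp [Finset.sum_mul]
  have e2 : ∀ i, f (b i) * f (T (B.dualBasis hB b i))
      = ∑ j, B (T (B.dualBasis hB b i)) (b j) • (f (b i) * f (B.dualBasis hB b j)) := by
    intro i
    conv_lhs => rw [h1 (T (B.dualBasis hB b i))]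
    simp [Finset.mul_sum]
  simp_rw [e1, e2]
  rw [Finset.sum_comm, ← Finset.sum_add_distrib]
  refine Finset.sum_eq_zero fun i _ => ?_
  rw [← Finset.sum_add_distrib]
  refine Finset.sum_eq_zero fun j _ => ?_
  rw [hT, hs.eq (T (B.dualBasis hB b i)), ← add_smul]
  simp

/-- Engel's theorem reduces this to nilpotency of each `ad x`, which embeds into the adjoint action
of the nilpotent endomorphism given by `x`. -/
theorem isNilpotent_of_isNilpotent_of_faithful {K L M : Type*} [Field K] [LieRing L]
    [LieAlgebra K L] [FiniteDimensional K L] [AddCommGroup M] [Module K M] [LieRingModule L M]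
    [LieModule K L M] [FiniteDimensional K M] [LieModule.IsNilpotent L M]
    (h : Function.Injective (toEnd K L M)) : LieRing.IsNilpotent L := by
  rw [LieAlgebra.isNilpotent_iff_forall (R := K)]
  intro x
  obtain ⟨n, hn⟩ := LieAlgebra.ad_nilpotent_of_nilpotent (R := K)
    (isNilpotent_toEnd_of_isNilpotent K L M x)
  refine ⟨n, LinearMap.ext fun y => h ?_⟩
  have key (k : ℕ) : ∀ y, toEnd K L M ((ad K L x ^ k) y)
      = (ad K (End K M) (toEnd K L M x) ^ k) (toEnd K L M y) := by
    induction k with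
    | zero => simp
    | succ k ih => intro y; simp only [pow_succ, Module.End.mul_apply, ih]; simp
  rw [key, hn]
  simp

/-- Cartan's criterion for a faithful module. -/
theorem isSolvable_of_traceForm_eq_zero_of_faithful {K L M : Type*} [Field K] [CharZero K]
    [LieRing L] [LieAlgebra K L] [FiniteDimensional K L] [AddCommGroup M] [Module K M]
    [LieRingModule L M] [LieModule K L M] [FiniteDimensional K M]
    (h : Function.Injective (toEnd K L M)) (h0 : traceForm K L M = 0) :
    LieAlgebra.IsSolvable L := by
  have hnil := isNilpotent_derivedSeries_of_traceForm_eq_zero h0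
  have hD : LieRing.IsNilpotent (derivedSeries K L 1) :=
    isNilpotent_of_isNilpotent_of_faithful (K := K) (M := M) fun x y hxy =>
      Subtype.ext (h hxy)
  obtain ⟨k, hk⟩ := IsSolvable.solvable K (derivedSeries K L 1)
  rw [LieIdeal.derivedSeries_eq_bot_iff] at hk
  refine IsSolvable.mk (R := K) (k := k + 1) ?_
  rw [derivedSeries_def, derivedSeriesOfIdeal_add]
  exact hk

/-- The ideal of elements of `J` that are orthogonal to `J` for the trace form of `M`. -/
def traceRadical (K : Type*) {L : Type*} (M : Type*) [Field K] [LieRing L] [LieAlgebra K L]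
    [AddCommGroup M] [Module K M] [LieRingModule L M] [LieModule K L M] (J : LieIdeal K L) :
    LieIdeal K L where
  carrier := {x | x ∈ J ∧ ∀ y ∈ J, traceForm K L M x y = 0}
  add_mem' {a b} ha hb := ⟨add_mem ha.1 hb.1, fun y hy => by simp [ha.2 y hy, hb.2 y hy]⟩
  zero_mem' := ⟨zero_mem _, by simp⟩
  smul_mem' c x hx := ⟨J.smul_mem c hx.1, fun y hy => by simp [hx.2 y hy]⟩
  lie_mem {x m} hm := ⟨J.lie_mem hm.1, fun y hy => by
    rw [← lie_skew, map_neg, LinearMap.neg_apply, traceForm_apply_lie_apply,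
      hm.2 _ (J.lie_mem hy), neg_zero]⟩

/-- The **Casimir operator** of a finite-dimensional module with nonzero action. It is formed from
dual bases, for the trace form of `M`, of the Killing complement `J` of the kernel of the action; on
`J` the action is faithful, so that the trace form is nondegenerate. Its trace is `dim J ≠ 0`. -/
theorem exists_casimir {K L M : Type*} [Field K] [CharZero K] [LieRing L] [LieAlgebra K L]
    [FiniteDimensional K L] [HasTrivialRadical K L] [AddCommGroup M] [Module K M]
    [LieRingModule L M] [LieModule K L M] [FiniteDimensional K M]
    (hM : ∃ x : L, toEnd K L M x ≠ 0) :
    ∃ c : End K M, (∀ x : L, Commute (toEnd K L M x) c) ∧ ¬ IsNilpotent c ∧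
      ∀ N : Submodule K M, (∀ (x : L) (m : M), ⁅x, m⁆ ∈ N) → ∀ m, c m ∈ N := by
  classical
  let I : LieIdeal K L := LieModule.ker K L M
  let J : LieIdeal K L := LieIdeal.killingCompl K L I
  have hIJ : IsCompl I J := LieIdeal.isCompl_killingCompl I
  have hinj : ∀ x ∈ J, toEnd K L M x = 0 → x = 0 := by
    intro x hx h
    have : x ∈ I ⊓ J := ⟨(LieModule.mem_ker K L M _).2 fun m => by
      simpa using congrArg (fun f => f m) h, hx⟩
    rwa [hIJ.inf_eq_bot, LieSubmodule.mem_bot] at this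
  have hrad : traceRadical K M J = ⊥ := by
    have hsol : LieAlgebra.IsSolvable (traceRadical K M J) := by
      refine isSolvable_of_traceForm_eq_zero_of_faithful (K := K) (M := M) ?_ ?_
      · refine (injective_iff_map_eq_zero _).2 fun x hx => Subtype.ext ?_
        exact hinj x x.2.1 hx
      · ext x y
        exact x.2.2 y y.2.1
    exact HasTrivialRadical.eq_bot_of_isSolvable _
  let B : LinearMap.BilinForm K J := (traceForm K L M).restrict J.toSubmodule
  have hBapp : ∀ x y : J, B x y = traceForm K L M x y := fun _ _ => rfl
  have hsymm : B.IsSymm := ⟨fun x y => by simp [hBapp, traceForm_comm K L M x.1 y.1]⟩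
  have hB : B.Nondegenerate := by
    refine hsymm.isRefl.nondegenerate_iff_separatingLeft.2 ?_
    intro x hx
    have : x.1 ∈ traceRadical K M J := ⟨x.2, fun y hy => hx ⟨y, hy⟩⟩
    rw [hrad] at this
    exact Subtype.ext this
  let b := Module.finBasis K J
  let f : J →ₗ[K] End K M := (toEnd K L M : L →ₗ[K] End K M) ∘ₗ J.toSubmodule.subtype
  let c : End K M := ∑ i, f (b i) * f (B.dualBasis hB b i)
  refine ⟨c, fun x => ?_, fun hc => ?_, fun N hN m => ?_⟩
  · have h0 := sum_dualBasis_skew hB hsymm b (toEnd K L J x) (fun u v => by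
      change traceForm K L M ⁅x, u.1⁆ v.1 = - traceForm K L M u.1 ⁅x, v.1⁆
      rw [← lie_skew, map_neg, LinearMap.neg_apply, traceForm_apply_lie_apply]) f
    have hf (u : J) : f (toEnd K L J x u) = ⁅toEnd K L M x, f u⁆ :=
      LieHom.map_lie (toEnd K L M) x u.1
    rw [commute_iff_lie_eq, lie_sum, ← h0]
    refine Finset.sum_congr rfl fun i _ => ?_
    rw [hf, hf, Ring.lie_def, Ring.lie_def, Ring.lie_def]
    noncomm_ring
  · have ht : LinearMap.trace K M c = Module.finrank K J := by
      have : ∀ i, LinearMap.trace K M (f (b i) * f (B.dualBasis hB b i)) = 1 := fun i => by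
        have := LinearMap.BilinForm.apply_dualBasis_right hB hsymm b i i
        rw [if_pos rfl] at this
        exact this
      simp [c, this]
    have h0 := (LinearMap.isNilpotent_trace_of_isNilpotent hc).eq_zero
    rw [ht, Nat.cast_eq_zero] at h0
    have hJ : J = ⊥ := by
      rw [← LieSubmodule.toSubmodule_eq_bot]
      exact Submodule.finrank_eq_zero.1 h0
    have hI : I = ⊤ := by simpa [hJ] using hIJ.sup_eq_top
    obtain ⟨x, hx⟩ := hM
    refine hx (LinearMap.ext fun m => ?_)
    exact (LieModule.mem_ker K L M _).1 (hI ▸ LieSubmodule.mem_top x : x ∈ I) m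
  · simp only [c, LinearMap.sum_apply]
    exact Submodule.sum_mem _ fun i _ => hN _ _

/-- For `N = L M` this says `M = L M + M ^ L`, a form of Weyl's theorem. -/
theorem exists_invariant_sub_mem_of_hasTrivialRadical {K L : Type*} [Field K] [CharZero K]
    [LieRing L] [LieAlgebra K L] [FiniteDimensional K L] [HasTrivialRadical K L]
    {M : Type*} [AddCommGroup M] [Module K M]
    [LieRingModule L M] [LieModule K L M] [FiniteDimensional K M] (N : Submodule K M)
    (hN : ∀ (x : L) (m : M), ⁅x, m⁆ ∈ N) (m : M) :
    ∃ m₀ : M, (∀ x : L, ⁅x, m₀⁆ = 0) ∧ m - m₀ ∈ N := by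
  induction hn : Module.finrank K M using Nat.strong_induction_on generalizing M with
  | _ n ih =>
  by_cases hM : ∃ x : L, toEnd K L M x ≠ 0
  · obtain ⟨c, hc, hnil, hcN⟩ := exists_casimir hM
    obtain ⟨k, hk, hk1⟩ := ((c.eventually_isCompl_ker_pow_range_pow).and
      (Filter.eventually_ge_atTop 1)).exists
    let M₀ : LieSubmodule K L M :=
      { LinearMap.ker (c ^ k) with
        lie_mem := fun {x u} hu => by
          have hu' : (c ^ k) u = 0 := hu
          change (c ^ k) ⁅x, u⁆ = 0
          have := congrArg (fun g => g u) ((hc x).pow_right k).eq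
          simp only [Module.End.mul_apply, toEnd_apply_apply, hu', lie_zero] at this
          exact this.symm }
    have hlt : Module.finrank K M₀ < n := by
      rw [← hn]
      refine Submodule.finrank_lt (s := LinearMap.ker (c ^ k)) fun h => hnil ⟨k, ?_⟩
      exact LinearMap.ker_eq_top.1 h
    have hm : m ∈ LinearMap.ker (c ^ k) ⊔ LinearMap.range (c ^ k) := by
      rw [hk.sup_eq_top]; trivial
    obtain ⟨u, hu, w, ⟨v, rfl⟩, rfl⟩ := Submodule.mem_sup.1 hm
    -- `range (c ^ k)` lies in `N` because `1 ≤ k`; the component in `ker (c ^ k)` is handled by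
    -- induction.
    obtain ⟨m₀, h0, h1⟩ := ih _ hlt (M := M₀) (N.comap M₀.toSubmodule.subtype)
      (fun x z => hN x z.1) ⟨u, hu⟩ rfl
    refine ⟨m₀.1, fun x => congrArg Subtype.val (h0 x), ?_⟩
    have h1' : u - m₀.1 ∈ N := h1
    have h2 : (c ^ k) v ∈ N := by
      obtain ⟨j, rfl⟩ : ∃ j, k = j + 1 := ⟨k - 1, by omega⟩
      rw [pow_succ']
      exact hcN N hN _
    rw [add_sub_right_comm]
    exact N.add_mem h1' h2
  · push Not at hM
    exact ⟨m, fun x => by simpa using congrArg (fun g => g m) (hM x), by simp⟩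

instance hasTrivialRadical_quotient_center {K L : Type*} [Field K] [LieRing L] [LieAlgebra K L]
    [FiniteDimensional K L] [HasCentralRadical K L] :
    HasTrivialRadical K (L ⧸ LieAlgebra.center K L) := by
  rw [hasTrivialRadical_iff_no_solvable_ideals]
  intro I hI
  obtain ⟨k, hk⟩ := IsSolvable.solvable K I
  rw [LieIdeal.derivedSeries_eq_bot_iff] at hk
  let q : L →ₗ[K] L ⧸ LieAlgebra.center K L :=
    (LieSubmodule.Quotient.mk' (LieAlgebra.center K L) : L →ₗ[K] _)
  have hq (x y : L) : q ⁅x, y⁆ = ⁅q x, q y⁆ := rfl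
  -- The preimage of the solvable ideal `I` is solvable, as an extension of `I` by the centre.
  let P : LieIdeal K L :=
    { I.toSubmodule.comap q with
      lie_mem := fun {x m} hm => by
        change q ⁅x, m⁆ ∈ I
        rw [hq]
        exact I.lie_mem hm }
  have hP (j : ℕ) : ∀ x ∈ derivedSeriesOfIdeal K L j P, q x ∈ derivedSeriesOfIdeal K _ j I := by
    induction j with
    | zero => exact fun x hx => hx
    | succ j ih =>
      intro x hx
      rw [derivedSeriesOfIdeal_succ, ← LieSubmodule.mem_toSubmodule,
        LieSubmodule.lieIdeal_oper_eq_linear_span'] at hx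
      induction hx using Submodule.span_induction with
      | mem x hx =>
        obtain ⟨a, ha, b, hb, rfl⟩ := hx
        rw [derivedSeriesOfIdeal_succ, hq]
        exact LieSubmodule.lie_mem_lie (ih a ha) (ih b hb)
      | zero => simp
      | add x y _ _ hx hy => rw [map_add]; exact add_mem hx hy
      | smul c x _ hx => rw [map_smul]; exact (derivedSeriesOfIdeal K _ (j + 1) I).smul_mem c hx
  have hPz : derivedSeriesOfIdeal K L k P ≤ LieAlgebra.center K L := fun x hx => by
    have := hP k x hx
    rw [hk, LieSubmodule.mem_bot] at this
    exact (LieSubmodule.Quotient.mk_eq_zero _).1 this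
  have hsol : LieAlgebra.IsSolvable P := by
    refine IsSolvable.mk (R := K) (k := k + 1) ?_
    rw [LieIdeal.derivedSeries_eq_bot_iff, derivedSeriesOfIdeal_succ, eq_bot_iff,
      LieSubmodule.lie_le_iff]
    intro x hx m hm
    rw [LieSubmodule.mem_bot]
    exact (LieModule.mem_maxTrivSubmodule K L L m).1 (hPz hm) x
  have hle : P ≤ LieAlgebra.center K L := by
    rw [← HasCentralRadical.radical_eq_center (R := K) (L := L)]
    exact (LieIdeal.solvable_iff_le_radical K L P).1 hsol
  rw [eq_bot_iff]
  intro y hy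
  obtain ⟨x, rfl⟩ := LieSubmodule.Quotient.surjective_mk' _ y
  exact (LieSubmodule.Quotient.mk_eq_zero _).2 (hle (show x ∈ P from hy))

/-- The reductive case, by passing to the quotient by the centre. -/
theorem exists_invariant_sub_mem {K L : Type*} [Field K] [CharZero K]
    [LieRing L] [LieAlgebra K L] [FiniteDimensional K L] [HasCentralRadical K L]
    {M : Type*} [AddCommGroup M] [Module K M] [LieRingModule L M] [LieModule K L M]
    [FiniteDimensional K M] (hz : ∀ z ∈ LieAlgebra.center K L, ∀ m : M, ⁅z, m⁆ = 0)
    (N : Submodule K M) (hN : ∀ (x : L) (m : M), ⁅x, m⁆ ∈ N) (m : M) :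
    ∃ m₀ : M, (∀ x : L, ⁅x, m₀⁆ = 0) ∧ m - m₀ ∈ N := by
  let Z := LieAlgebra.center K L
  let σ : L ⧸ Z →ₗ⁅K⁆ End K M :=
    { Z.toSubmodule.liftQ (toEnd K L M : L →ₗ[K] End K M)
        (fun z hz' => LinearMap.ext fun m => hz z hz' m) with
      map_lie' := by
        intro x y
        obtain ⟨x, rfl⟩ := LieSubmodule.Quotient.surjective_mk' _ x
        obtain ⟨y, rfl⟩ := LieSubmodule.Quotient.surjective_mk' _ y
        exact LieHom.map_lie (toEnd K L M) x y }
  let _ : LieRingModule (L ⧸ Z) M := LieRingModule.compLieHom M σ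
  let _ : LieModule K (L ⧸ Z) M := LieModule.compLieHom M σ
  have hσ (x : L) (m : M) : ⁅(LieSubmodule.Quotient.mk' Z x : L ⧸ Z), m⁆ = ⁅x, m⁆ := rfl
  obtain ⟨m₀, h0, h1⟩ := exists_invariant_sub_mem_of_hasTrivialRadical (K := K) (L := L ⧸ Z) N
    (fun x m => by
      obtain ⟨x, rfl⟩ := LieSubmodule.Quotient.surjective_mk' _ x
      exact hN x m) m
  exact ⟨m₀, fun x => h0 (LieSubmodule.Quotient.mk' Z x), h1⟩

end Weyl

/-! ### Surjectivity of the evaluation action -/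

section Burnside

attribute [local instance 100] LieRing.ofAssociativeRing

/-- **Burnside's theorem**: a subalgebra of `End V` without proper nonzero invariant subspaces is
everything. This is Jacobson density, since by Schur's lemma every `K`-linear map commutes with
the `A`-linear ones. -/
theorem eq_top_of_forall_invariant {K V : Type*} [Field K] [IsAlgClosed K] [AddCommGroup V]
    [Module K V] [FiniteDimensional K V] [Nontrivial V] (A : Subalgebra K (Module.End K V))
    (hA : ∀ N : Submodule K V, (∀ a ∈ A, ∀ n ∈ N, a n ∈ N) → N = ⊥ ∨ N = ⊤) : A = ⊤ := by
  have hsimple : IsSimpleModule A V := by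
    rw [isSimpleModule_iff]
    refine ⟨fun N => ?_⟩
    have := hA (N.restrictScalars K) fun a ha n hn => N.smul_mem ⟨a, ha⟩ hn
    simpa using this
  rw [eq_top_iff]
  intro f _
  have hschur := (IsSimpleModule.algebraMap_end_bijective_of_isAlgClosed K (A := A) (V := V)).2
  let f' : Module.End (Module.End A V) V :=
    { toFun := f
      map_add' := f.map_add
      map_smul' := fun g v => by
        obtain ⟨c, rfl⟩ := hschur g
        simp }
  classical
  let b := Module.finBasis K V
  obtain ⟨r, hr⟩ := jacobson_density f' (Finset.univ.image b)
  have : f = r.1 := b.ext fun i => hr (b i) (by simp)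
  rw [this]
  exact r.2

theorem actOnFactor_one {R : Type*} [CommRing R] {ι : Type*} [DecidableEq ι]
    {V : ι → Type*} [∀ i, AddCommGroup (V i)] [∀ i, Module R (V i)] (i : ι) :
    actOnFactor i (1 : Module.End R (V i)) = 1 := by
  apply PiTensorProduct.ext
  ext v
  simp [actOnFactor_tprod]

theorem actOnFactor_mul {R : Type*} [CommRing R] {ι : Type*} [DecidableEq ι]
    {V : ι → Type*} [∀ i, AddCommGroup (V i)] [∀ i, Module R (V i)] (i : ι)
    (f g : Module.End R (V i)) : actOnFactor i (f * g) = actOnFactor i f * actOnFactor i g := by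
  apply PiTensorProduct.ext
  ext v
  simp [actOnFactor_tprod]

/-- `actOnFactor i` as a morphism of algebras `End (V i) → End (⨂ V)`. -/
def actOnFactorHom {R : Type*} [CommRing R] {ι : Type*} [DecidableEq ι]
    {V : ι → Type*} [∀ i, AddCommGroup (V i)] [∀ i, Module R (V i)] (i : ι) :
    Module.End R (V i) →ₐ[R] Module.End R (⨂[R] j, V j) :=
  AlgHom.ofLinearMap (actOnFactor i) (actOnFactor_one i) (actOnFactor_mul i)

theorem piTensorProduct_map_mem {R : Type*} [CommRing R] {ι : Type*} [Fintype ι] [DecidableEq ι]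
    {V : ι → Type*} [∀ i, AddCommGroup (V i)] [∀ i, Module R (V i)]
    (A : Subalgebra R (Module.End R (⨂[R] i, V i)))
    (hA : ∀ i (f : Module.End R (V i)), actOnFactor i f ∈ A) (f : ∀ i, Module.End R (V i)) :
    PiTensorProduct.map f ∈ A := by
  have h : f ∈ (A.toSubmonoid.comap
      (PiTensorProduct.mapMonoidHom (R := R) (s := V)) : Submonoid (∀ i, Module.End R (V i))) := by
    rw [← Finset.noncommProd_mulSingle f]
    exact Submonoid.noncommProd_mem _ _ _ _ fun i _ => hA i (f i)
  exact h

/-- The matrix units for the tensor product basis are tensor products of matrix units. -/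
theorem eq_top_of_actOnFactor_mem {K : Type*} [Field K] {ι : Type*} [Fintype ι] [DecidableEq ι]
    {V : ι → Type*} [∀ i, AddCommGroup (V i)] [∀ i, Module K (V i)]
    [∀ i, FiniteDimensional K (V i)] (A : Subalgebra K (Module.End K (⨂[K] i, V i)))
    (hA : ∀ i (f : Module.End K (V i)), actOnFactor i f ∈ A) : A = ⊤ := by
  classical
  let b := fun i => Module.finBasis K (V i)
  let B := Basis.piTensorProduct b
  have hB : ∀ pq, B.end pq ∈ A := by
    rintro ⟨p, q⟩
    have : B.end (p, q) = PiTensorProduct.map fun i => (b i).end (p i, q i) := by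
      refine B.ext fun r => ?_
      rw [Module.Basis.linearMap_apply_apply, Basis.piTensorProduct_apply,
        Basis.piTensorProduct_apply, PiTensorProduct.map_tprod]
      simp only [Module.Basis.linearMap_apply_apply]
      by_cases h : q = r
      · subst h; simp
      · rw [if_neg h]
        obtain ⟨i, hi⟩ := Function.ne_iff.1 h
        exact ((PiTensorProduct.tprod K).map_coord_zero i (by simp [hi])).symm
    rw [this]
    exact piTensorProduct_map_mem A hA _
  rw [eq_top_iff]
  intro f _
  rw [← B.end.sum_repr f]
  exact Subalgebra.sum_mem _ fun i _ => A.smul_mem (hB i) _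

variable {𝔤 : Type*} [LieRing 𝔤] [LieAlgebra ℂ 𝔤] {ι : Type*} [Fintype ι] [DecidableEq ι]
  (V : ι → Type*) [∀ i, AddCommGroup (V i)] [∀ i, Module ℂ (V i)]
  [∀ i, LieRingModule 𝔤 (V i)] [∀ i, LieModule ℂ 𝔤 (V i)] (p : ι → ℂ)

theorem evalRep_tmul (P : ℂ[X]) (x : 𝔤) :
    evalRep V p (P ⊗ₜ x) = ∑ i, P.eval (p i) • actOnFactor i (LieModule.toEnd ℂ 𝔤 (V i) x) := by
  apply PiTensorProduct.ext
  ext v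
  simp [evalRep_tprod, actOnFactor_tprod]

theorem evalRep_one_tmul (x : 𝔤) :
    evalRep V p (1 ⊗ₜ x) = LieModule.toEnd ℂ 𝔤 (⨂[ℂ] i, V i) x := by
  apply PiTensorProduct.ext
  ext v
  simp [evalRep_tprod, lie_tprod]

theorem lift_evalRep_surjective [∀ i, FiniteDimensional ℂ (V i)]
    [∀ i, LieModule.IsIrreducible ℂ 𝔤 (V i)] (hp : Function.Injective p) :
    Function.Surjective (UniversalEnvelopingAlgebra.lift ℂ (evalRep (𝔤 := 𝔤) V p)) := by
  rw [← AlgHom.range_eq_top]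
  set A := (UniversalEnvelopingAlgebra.lift ℂ (evalRep (𝔤 := 𝔤) V p)).range
  refine eq_top_of_actOnFactor_mem A fun i => ?_
  have hgen (x : 𝔤) : actOnFactor i (LieModule.toEnd ℂ 𝔤 (V i) x) ∈ A := by
    -- The Lagrange polynomial takes the value `1` at `p i` and `0` at the other points.
    refine ⟨UniversalEnvelopingAlgebra.ι ℂ (Lagrange.basis Finset.univ p i ⊗ₜ[ℂ] x), ?_⟩
    erw [UniversalEnvelopingAlgebra.lift_ι_apply, evalRep_tmul V p _ x]
    rw [Finset.sum_eq_single i, Lagrange.eval_basis_self hp.injOn (Finset.mem_univ i), one_smul]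
    · intro j _ hj
      rw [Lagrange.eval_basis_of_ne hj.symm (Finset.mem_univ j), zero_smul]
    · simp
  have := LieModule.nontrivial_of_isIrreducible ℂ 𝔤 (V i)
  have htop : A.comap (actOnFactorHom i) = ⊤ := by
    refine eq_top_of_forall_invariant _ fun N hN => ?_
    let N' : LieSubmodule ℂ 𝔤 (V i) :=
      { N with lie_mem := fun {x m} hm => hN (LieModule.toEnd ℂ 𝔤 (V i) x) (hgen x) m hm }
    rcases IsSimpleOrder.eq_bot_or_eq_top N' with h | h
    · exact Or.inl (by simpa [N'] using congrArg LieSubmodule.toSubmodule h)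
    · exact Or.inr (by simpa [N'] using congrArg LieSubmodule.toSubmodule h)
  intro f
  have : f ∈ A.comap (actOnFactorHom i) := htop ▸ trivial
  exact this

end Burnside

/-! ### The adjoint action of `𝔤` on `U(𝔤[t])` and lifting of equivariant maps -/

section LocalFiniteness

attribute [local instance 100] LieRing.ofAssociativeRing

theorem adjoin_range_ι_eq_top (R L : Type*) [CommRing R] [LieRing L] [LieAlgebra R L] :
    Algebra.adjoin R (Set.range (UniversalEnvelopingAlgebra.ι R (L := L))) = ⊤ := by
  set A := Algebra.adjoin R (Set.range (UniversalEnvelopingAlgebra.ι R (L := L)))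
  let j : L →ₗ⁅R⁆ A :=
    { LinearMap.codRestrict (Subalgebra.toSubmodule A)
        (UniversalEnvelopingAlgebra.ι R : L →ₗ⁅R⁆ UniversalEnvelopingAlgebra R L).toLinearMap
        fun x => Algebra.subset_adjoin ⟨x, rfl⟩ with
      map_lie' := fun {x y} => Subtype.ext (LieHom.map_lie (UniversalEnvelopingAlgebra.ι R) x y) }
  have h : A.val.comp (UniversalEnvelopingAlgebra.lift R j) = AlgHom.id R _ := by
    apply UniversalEnvelopingAlgebra.hom_ext
    ext x
    change A.val (UniversalEnvelopingAlgebra.lift R j (UniversalEnvelopingAlgebra.ι R x)) = _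
    rw [UniversalEnvelopingAlgebra.lift_ι_apply]
    rfl
  rw [eq_top_iff]
  intro u _
  have := congrArg (fun g => g u) h
  rw [show u = _ from this.symm]
  exact (UniversalEnvelopingAlgebra.lift R j u).2

variable (𝔤 : Type*) [LieRing 𝔤] [LieAlgebra ℂ 𝔤]

/-- The inclusion `x ↦ 1 ⊗ x` of `𝔤` into `U(𝔤[t])` as the constant currents. -/
noncomputable def constCurrent : 𝔤 →ₗ⁅ℂ⁆ UniversalEnvelopingAlgebra ℂ (Current 𝔤) :=
  (UniversalEnvelopingAlgebra.ι ℂ).comp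
    { TensorProduct.mk ℂ ℂ[X] 𝔤 1 with
      map_lie' := fun {x y} => by simp }

theorem constCurrent_apply (x : 𝔤) :
    constCurrent 𝔤 x = UniversalEnvelopingAlgebra.ι ℂ ((1 : ℂ[X]) ⊗ₜ[ℂ] x) := rfl

variable {𝔤}

theorem lie_constCurrent_ι_tmul (x y : 𝔤) (P : ℂ[X]) :
    ⁅constCurrent 𝔤 x, UniversalEnvelopingAlgebra.ι ℂ (P ⊗ₜ[ℂ] y)⁆
      = UniversalEnvelopingAlgebra.ι ℂ (P ⊗ₜ[ℂ] ⁅x, y⁆) := by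
  rw [constCurrent_apply, ← LieHom.map_lie]
  simp

theorem lie_mul_eq {A : Type*} [Ring A] (c a b : A) : ⁅c, a * b⁆ = ⁅c, a⁆ * b + a * ⁅c, b⁆ := by
  simp only [Ring.lie_def]; noncomm_ring

/-- The adjoint action of `𝔤` on `U(𝔤[t])` is locally finite: the elements lying in a
finite-dimensional stable subspace form a subalgebra, which contains the generators `P ⊗ y` because
`P ⊗ 𝔤` is stable. -/
theorem exists_finiteDimensional_lie_stable [FiniteDimensional ℂ 𝔤]
    (u : UniversalEnvelopingAlgebra ℂ (Current 𝔤)) :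
    ∃ E : Submodule ℂ (UniversalEnvelopingAlgebra ℂ (Current 𝔤)), E.FG ∧
      (∀ x : 𝔤, ∀ e ∈ E, ⁅constCurrent 𝔤 x, e⁆ ∈ E) ∧ u ∈ E := by
  have hu : u ∈ Algebra.adjoin ℂ (Set.range (UniversalEnvelopingAlgebra.ι ℂ (L := Current 𝔤))) := by
    rw [adjoin_range_ι_eq_top]; trivial
  have hadd : ∀ a b : UniversalEnvelopingAlgebra ℂ (Current 𝔤),
      (∃ E : Submodule ℂ (UniversalEnvelopingAlgebra ℂ (Current 𝔤)), E.FG ∧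
        (∀ x : 𝔤, ∀ e ∈ E, ⁅constCurrent 𝔤 x, e⁆ ∈ E) ∧ a ∈ E) →
      (∃ E : Submodule ℂ (UniversalEnvelopingAlgebra ℂ (Current 𝔤)), E.FG ∧
        (∀ x : 𝔤, ∀ e ∈ E, ⁅constCurrent 𝔤 x, e⁆ ∈ E) ∧ b ∈ E) →
      ∃ E : Submodule ℂ (UniversalEnvelopingAlgebra ℂ (Current 𝔤)), E.FG ∧
        (∀ x : 𝔤, ∀ e ∈ E, ⁅constCurrent 𝔤 x, e⁆ ∈ E) ∧ a + b ∈ E := by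
    rintro a b ⟨E, hE, hE', ha⟩ ⟨F, hF, hF', hb⟩
    refine ⟨E ⊔ F, hE.sup hF, fun x e he => ?_, Submodule.add_mem_sup ha hb⟩
    obtain ⟨y, hy, z, hz, rfl⟩ := Submodule.mem_sup.1 he
    rw [lie_add]
    exact Submodule.add_mem_sup (hE' x y hy) (hF' x z hz)
  induction hu using Algebra.adjoin_induction with
  | mem u hu =>
    obtain ⟨a, rfl⟩ := hu
    induction a using TensorProduct.induction_on with
    | zero => exact ⟨⊥, Submodule.fg_bot, by simp, by simp⟩
    | add a b ha hb => rw [map_add]; exact hadd _ _ ha hb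
    | tmul P y =>
      let j : 𝔤 →ₗ[ℂ] UniversalEnvelopingAlgebra ℂ (Current 𝔤) :=
        (UniversalEnvelopingAlgebra.ι ℂ (L := Current 𝔤)).toLinearMap ∘ₗ
          TensorProduct.mk ℂ ℂ[X] 𝔤 P
      refine ⟨LinearMap.range j, Module.Finite.fg_top.map j |> fun h => by
        rwa [Submodule.map_top] at h, ?_, ⟨y, rfl⟩⟩
      rintro x _ ⟨z, rfl⟩
      exact ⟨⁅x, z⁆, (lie_constCurrent_ι_tmul x z P).symm⟩
  | algebraMap c =>
    refine ⟨Submodule.span ℂ {1}, Submodule.fg_span_singleton 1, fun x e he => ?_, ?_⟩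
    · obtain ⟨c, rfl⟩ := Submodule.mem_span_singleton.1 he
      simp [Ring.lie_def]
    · exact Submodule.mem_span_singleton.2 ⟨c, (Algebra.algebraMap_eq_smul_one c).symm⟩
  | add a b _ _ ha hb => exact hadd _ _ ha hb
  | mul a b _ _ ha hb =>
    obtain ⟨E, hE, hE', ha⟩ := ha
    obtain ⟨F, hF, hF', hb⟩ := hb
    refine ⟨E * F, hE.mul hF, fun x e he => ?_, Submodule.mul_mem_mul ha hb⟩
    induction he using Submodule.mul_induction_on' with
    | mem_mul_mem m hm n hn =>
      rw [lie_mul_eq]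
      exact add_mem (Submodule.mul_mem_mul (hE' x m hm) hn) (Submodule.mul_mem_mul hm (hF' x n hn))
    | add a _ b _ ha hb => rw [lie_add]; exact add_mem ha hb

theorem lie_constCurrent_of_mem_center {z : 𝔤} (hz : z ∈ LieAlgebra.center ℂ 𝔤)
    (u : UniversalEnvelopingAlgebra ℂ (Current 𝔤)) : ⁅constCurrent 𝔤 z, u⁆ = 0 := by
  have hu : u ∈ Algebra.adjoin ℂ (Set.range (UniversalEnvelopingAlgebra.ι ℂ (L := Current 𝔤))) := by
    rw [adjoin_range_ι_eq_top]; trivial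
  induction hu using Algebra.adjoin_induction with
  | mem u hu =>
    obtain ⟨a, rfl⟩ := hu
    induction a using TensorProduct.induction_on with
    | zero => simp
    | add a b ha hb => rw [map_add, lie_add, ha, hb, add_zero]
    | tmul P y =>
      have : ⁅z, y⁆ = 0 := by
        rw [← lie_skew, (LieModule.mem_maxTrivSubmodule ℂ 𝔤 𝔤 z).1 hz y, neg_zero]
      rw [lie_constCurrent_ι_tmul, this, TensorProduct.tmul_zero, map_zero]
  | algebraMap c => simp [Ring.lie_def, Algebra.commutes]
  | add a b _ _ ha hb => rw [lie_add, ha, hb, add_zero]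
  | mul a b _ _ ha hb => rw [lie_mul_eq, ha, hb, zero_mul, mul_zero, add_zero]

variable {ι : Type*} [Fintype ι] [DecidableEq ι]
  (V : ι → Type*) [∀ i, AddCommGroup (V i)] [∀ i, Module ℂ (V i)]
  [∀ i, LieRingModule 𝔤 (V i)] [∀ i, LieModule ℂ 𝔤 (V i)] (p : ι → ℂ)

theorem lift_evalRep_constCurrent (x : 𝔤) :
    UniversalEnvelopingAlgebra.lift ℂ (evalRep V p) (constCurrent 𝔤 x)
      = LieModule.toEnd ℂ 𝔤 (⨂[ℂ] i, V i) x := by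
  rw [constCurrent_apply, UniversalEnvelopingAlgebra.lift_ι_apply, evalRep_one_tmul]

theorem lift_evalRep_lie_constCurrent (x : 𝔤) (u : UniversalEnvelopingAlgebra ℂ (Current 𝔤))
    (w : ⨂[ℂ] i, V i) :
    UniversalEnvelopingAlgebra.lift ℂ (evalRep V p) ⁅constCurrent 𝔤 x, u⁆ w
      = ⁅x, UniversalEnvelopingAlgebra.lift ℂ (evalRep V p) u w⁆
        - UniversalEnvelopingAlgebra.lift ℂ (evalRep V p) u ⁅x, w⁆ := by
  rw [Ring.lie_def, map_sub, map_mul, map_mul, lift_evalRep_constCurrent]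
  rfl

theorem invariantsAction_lie (a : invariants 𝔤) (x : 𝔤) (w : ⨂[ℂ] i, V i) :
    ⁅x, invariantsAction 𝔤 V p a w⁆ = invariantsAction 𝔤 V p a ⁅x, w⁆ := by
  have h := lift_evalRep_lie_constCurrent V p x a.1 w
  rw [show ⁅constCurrent 𝔤 x, a.1⁆ = 0 from a.2 x, map_zero, LinearMap.zero_apply] at h
  exact sub_eq_zero.1 h.symm

/-- Every `𝔤`-equivariant map from a submodule of the evaluation module to the evaluation module is
the restriction of the action of an element of `U(𝔤[t])^𝔤`. -/
theorem exists_invariantsAction_eq [FiniteDimensional ℂ 𝔤] [LieAlgebra.HasCentralRadical ℂ 𝔤]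
    [∀ i, FiniteDimensional ℂ (V i)] [∀ i, LieModule.IsIrreducible ℂ 𝔤 (V i)]
    (hp : Function.Injective p) (N : LieSubmodule ℂ 𝔤 (⨂[ℂ] i, V i))
    (φ : N →ₗ⁅ℂ,𝔤⁆ ⨂[ℂ] i, V i) :
    ∃ a : invariants 𝔤, ∀ n : N, invariantsAction 𝔤 V p a n = φ n := by
  let U := UniversalEnvelopingAlgebra ℂ (Current 𝔤)
  let π : U →ₐ[ℂ] Module.End ℂ (⨂[ℂ] i, V i) := UniversalEnvelopingAlgebra.lift ℂ (evalRep V p)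
  have hπ (x : 𝔤) (u : U) (w) : π ⁅constCurrent 𝔤 x, u⁆ w = ⁅x, π u w⁆ - π u ⁅x, w⁆ :=
    lift_evalRep_lie_constCurrent V p x u w
  obtain ⟨f, hf⟩ := LinearMap.exists_extend (p := N.toSubmodule) φ.toLinearMap
  have hf (n : N) : f n = φ n := congrArg (fun g => g n) hf
  obtain ⟨u, hu⟩ := lift_evalRep_surjective (𝔤 := 𝔤) V p hp f
  have hu : π u = f := hu
  obtain ⟨E, hE, hEx, huE⟩ := exists_finiteDimensional_lie_stable u
  let _ : LieRingModule 𝔤 U := LieRingModule.compLieHom U (constCurrent 𝔤)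
  let _ : LieModule ℂ 𝔤 U := LieModule.compLieHom U (constCurrent 𝔤)
  -- Elements of `E` that act equivariantly on `N`; the adjoint action of `𝔤` carries them to elements
  -- that kill `N`.
  let M : LieSubmodule ℂ 𝔤 U :=
    { carrier := {v | v ∈ E ∧ ∀ x : 𝔤, ∀ n ∈ N, π v ⁅x, n⁆ = ⁅x, π v n⁆}
      add_mem' := fun {a b} ha hb => ⟨add_mem ha.1 hb.1, fun x n hn => by
        simp [ha.2 x n hn, hb.2 x n hn]⟩
      zero_mem' := ⟨zero_mem _, by simp⟩
      smul_mem' := fun c a ha => ⟨E.smul_mem c ha.1, fun x n hn => by simp [ha.2 x n hn]⟩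
      lie_mem := fun {x v} hv => ⟨hEx x v hv.1, fun y n hn => by
        change π ⁅constCurrent 𝔤 x, v⁆ ⁅y, n⁆ = ⁅y, π ⁅constCurrent 𝔤 x, v⁆ n⁆
        rw [hπ, hπ, hv.2 x n hn, hv.2 x _ (N.lie_mem hn), sub_self, sub_self, lie_zero]⟩ }
  have hME : M.toSubmodule ≤ E := fun v hv => hv.1
  have : FiniteDimensional ℂ E := Module.Finite.iff_fg.2 hE
  have : FiniteDimensional ℂ M := Submodule.finiteDimensional_of_le hME
  let N' : Submodule ℂ M :=
    { carrier := {v | ∀ n ∈ N, π v.1 n = 0}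
      add_mem' := fun {a b} ha hb n hn => by simp [ha n hn, hb n hn]
      zero_mem' := by simp
      smul_mem' := fun c a ha n hn => by simp [ha n hn] }
  obtain ⟨u₀, h0, h1⟩ := exists_invariant_sub_mem (K := ℂ) (L := 𝔤) (M := M)
    (fun z hz v => Subtype.ext (lie_constCurrent_of_mem_center hz v.1)) N'
    (fun x v n hn => by
      change π ⁅constCurrent 𝔤 x, v.1⁆ n = 0
      rw [hπ, v.2.2 x n hn, sub_self])
    ⟨u, huE, fun x n hn => by
      rw [hu, hf ⟨n, hn⟩]
      exact (hf ⟨⁅x, n⁆, N.lie_mem hn⟩).trans (φ.map_lie x ⟨n, hn⟩)⟩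
  refine ⟨⟨u₀.1, fun x => congrArg Subtype.val (h0 x)⟩, fun n => ?_⟩
  have h2 : π (u - u₀.1) n = 0 := h1 n n.2
  rw [map_sub, hu, LinearMap.sub_apply, hf, sub_eq_zero] at h2
  exact h2.symm

end LocalFiniteness

/-! ### Isotypic components of Lie modules -/

section Isotypic

variable {R L M S : Type*} [CommRing R] [LieRing L]
  [AddCommGroup M] [Module R M] [LieRingModule L M]
  [AddCommGroup S] [Module R S] [LieRingModule L S]

theorem nonempty_equiv_of_range_eq {M₁ M₂ : Type*} [AddCommGroup M₁] [Module R M₁]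
    [LieRingModule L M₁] [AddCommGroup M₂] [Module R M₂] [LieRingModule L M₂]
    (f : M₁ →ₗ⁅R,L⁆ M) (g : M₂ →ₗ⁅R,L⁆ M) (hf : Function.Injective f)
    (hg : Function.Injective g) (h : LinearMap.range f.toLinearMap = LinearMap.range g.toLinearMap) :
    Nonempty (M₁ ≃ₗ⁅R,L⁆ M₂) := by
  let e : M₁ ≃ₗ[R] M₂ := LinearEquiv.ofInjective f.toLinearMap hf ≪≫ₗ LinearEquiv.ofEq _ _ h ≪≫ₗ
    (LinearEquiv.ofInjective g.toLinearMap hg).symm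
  have he (x : M₁) : g (e x) = f x := by
    have := LinearEquiv.apply_symm_apply (LinearEquiv.ofInjective g.toLinearMap hg)
      (LinearEquiv.ofEq _ _ h (LinearEquiv.ofInjective f.toLinearMap hf x))
    exact congrArg Subtype.val this
  exact ⟨{ e with
    map_lie' := fun {x m} => hg (by
      change g (e ⁅x, m⁆) = g ⁅x, e m⁆
      rw [he, g.map_lie, he, f.map_lie]) }⟩

theorem isIrreducible_of_equiv [LieModule.IsIrreducible R L S] (e : M ≃ₗ⁅R,L⁆ S) :
    LieModule.IsIrreducible R L M :=
  (LieSubmodule.orderIsoMapComap e).isSimpleOrder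

variable [LieAlgebra R L] [LieModule R L M] [LieModule R L S]

/-- By Schur's lemma, `f` kills each copy of `S` or maps it to another copy of `S`. -/
theorem map_mem_isotypicComponent [LieModule.IsIrreducible R L S] (f : M →ₗ⁅R,L⁆ M) {m : M}
    (hm : m ∈ isotypicComponent R L M S) : f m ∈ isotypicComponent R L M S := by
  suffices h : isotypicComponent R L M S ≤ (isotypicComponent R L M S).comap f from h hm
  refine sSup_le ?_
  rintro T ⟨e⟩ t ht
  have := isIrreducible_of_equiv e
  let g : T →ₗ⁅R,L⁆ M := f.comp T.incl
  change g ⟨t, ht⟩ ∈ isotypicComponent R L M S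
  rcases eq_bot_or_eq_top g.ker with h | h
  · have hg := g.ker_eq_bot.1 h
    obtain ⟨e'⟩ := nonempty_equiv_of_range_eq g.range.incl g Subtype.val_injective hg
      (Submodule.range_subtype (LinearMap.range g.toLinearMap))
    have hle : g.range ≤ isotypicComponent R L M S := le_sSup ⟨e'.trans e⟩
    exact hle ((LieModuleHom.mem_range g _).2 ⟨_, rfl⟩)
  · have : (⟨t, ht⟩ : T) ∈ g.ker := h ▸ LieSubmodule.mem_top _
    rw [LieModuleHom.mem_ker.1 this]
    exact zero_mem _

/-- A simple submodule of the isotypic component of type `S` is isomorphic to `S`. Take `A` maximal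
among the submodules not containing `N`, and a copy `T` of `S` not contained in `A`. Then `N` and
`T` both embed into `M / A`, and the image of `N` is a nonzero submodule of that of `T`. -/
theorem nonempty_equiv_of_isAtom_of_le [IsNoetherian R M] [LieModule.IsIrreducible R L S]
    {N : LieSubmodule R L M} (hN : IsAtom N) (hle : N ≤ isotypicComponent R L M S) :
    Nonempty (N ≃ₗ⁅R,L⁆ S) := by
  have := LieSubmodule.wellFoundedGT_of_noetherian R L M
  obtain ⟨A, hA, hmax⟩ := wellFounded_gt.has_min {A : LieSubmodule R L M | ¬ N ≤ A}
    ⟨⊥, fun h => hN.1 (le_bot_iff.1 h)⟩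
  obtain ⟨T, ⟨e⟩, hT⟩ : ∃ T : LieSubmodule R L M, Nonempty (T ≃ₗ⁅R,L⁆ S) ∧ ¬ T ≤ A := by
    by_contra! h
    exact hA (hle.trans (sSup_le fun T hT => h T hT))
  have := isIrreducible_of_equiv e
  have hTA : T ⊓ A = ⊥ := by
    rcases eq_bot_or_eq_top (A.comap T.incl) with h | h
    · exact LieSubmodule.comap_incl_eq_bot.1 h
    · exact absurd (LieSubmodule.comap_incl_eq_top.1 h) hT
  have hNA : N ⊓ A = ⊥ := (hN.le_iff.1 inf_le_left).resolve_right fun h => hA (inf_eq_left.1 h)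
  have hNAT : N ≤ A ⊔ T := by
    by_contra h
    exact hmax _ h (lt_of_le_of_ne le_sup_left fun h => hT (h ▸ le_sup_right))
  let q := LieSubmodule.Quotient.mk' A
  have hq (m : M) : q m = 0 ↔ m ∈ A := LieSubmodule.Quotient.mk_eq_zero A
  have hinj (P : LieSubmodule R L M) (hP : P ⊓ A = ⊥) : Function.Injective (q.comp P.incl) := by
    refine (injective_iff_map_eq_zero _).2 fun x hx => Subtype.ext ?_
    have : x.1 ∈ P ⊓ A := ⟨x.2, (hq _).1 hx⟩
    rwa [hP] at this
  have hsub : ∀ n ∈ N, ∃ t ∈ T, q n = q t := by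
    intro n hn
    obtain ⟨a, ha, t, ht, rfl⟩ := (LieSubmodule.mem_sup A T n).1 (hNAT hn)
    exact ⟨t, ht, by rw [map_add, (hq a).2 ha, zero_add]⟩
  have hsup : ∀ t ∈ T, ∃ n ∈ N, q n = q t := by
    rcases eq_bot_or_eq_top ((N.map q).comap (q.comp T.incl)) with h | h
    · exfalso
      refine hN.1 ((LieSubmodule.eq_bot_iff N).2 fun n hn => ?_)
      obtain ⟨t, ht, hnt⟩ := hsub n hn
      have h0 : (⟨t, ht⟩ : T) ∈ (N.map q).comap (q.comp T.incl) :=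
        (LieSubmodule.mem_map _).2 ⟨n, hn, hnt⟩
      rw [h, LieSubmodule.mem_bot] at h0
      have ht0 : t = 0 := congrArg Subtype.val h0
      rw [ht0, map_zero, hq] at hnt
      have : n ∈ N ⊓ A := ⟨hn, hnt⟩
      rwa [hNA] at this
    · intro t ht
      have h0 : (⟨t, ht⟩ : T) ∈ (N.map q).comap (q.comp T.incl) := h ▸ LieSubmodule.mem_top _
      exact (LieSubmodule.mem_map _).1 h0
  obtain ⟨e'⟩ := nonempty_equiv_of_range_eq (q.comp N.incl) (q.comp T.incl) (hinj N hNA)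
    (hinj T hTA) (by
      ext y
      constructor
      · rintro ⟨n, rfl⟩
        obtain ⟨t, ht, h⟩ := hsub n n.2
        exact ⟨⟨t, ht⟩, h.symm⟩
      · rintro ⟨t, rfl⟩
        obtain ⟨n, hn, h⟩ := hsup t t.2
        exact ⟨⟨n, hn⟩, h⟩)
  exact ⟨e'.trans e⟩

end Isotypic

end CurrentAlgebra

theorem theorem9
    {𝔤 : Type*} [LieRing 𝔤] [LieAlgebra ℂ 𝔤] [FiniteDimensional ℂ 𝔤]
    [LieAlgebra.HasCentralRadical ℂ 𝔤]
    {d : ℕ} (V : Fin d → Type*) [∀ i, AddCommGroup (V i)] [∀ i, Module ℂ (V i)]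
    [∀ i, LieRingModule 𝔤 (V i)] [∀ i, LieModule ℂ 𝔤 (V i)]
    [∀ i, FiniteDimensional ℂ (V i)] [∀ i, LieModule.IsIrreducible ℂ 𝔤 (V i)]
    (p : Fin d → ℂ) (hp : Function.Injective p)
    (S : Type*) [AddCommGroup S] [Module ℂ S] [LieRingModule 𝔤 S] [LieModule ℂ 𝔤 S]
    [LieModule.IsIrreducible ℂ 𝔤 S]
    (hS : CurrentAlgebra.isotypicComponent ℂ 𝔤 (⨂[ℂ] i, V i) S ≠ ⊥) :
    CurrentAlgebra.IsIrreducibleJoint (CurrentAlgebra.invariantsAction 𝔤 V p)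
      (CurrentAlgebra.isotypicComponent ℂ 𝔤 (⨂[ℂ] i, V i) S) where
  stable a m hm := CurrentAlgebra.map_mem_isotypicComponent
    { CurrentAlgebra.invariantsAction 𝔤 V p a with
      map_lie' := fun {x w} => (CurrentAlgebra.invariantsAction_lie V p a x w).symm } hm
  commute x a m _ := CurrentAlgebra.invariantsAction_lie V p a x m
  ne_bot := hS
  eq_bot_or_eq N hN hstable := by
    refine or_iff_not_imp_left.2 fun hbot => le_antisymm hN (sSup_le ?_)
    rintro T ⟨e⟩ t ht
    obtain ⟨N₀, hN₀, hle⟩ := (eq_bot_or_exists_atom_le N).resolve_left hbot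
    obtain ⟨e₀⟩ := CurrentAlgebra.nonempty_equiv_of_isAtom_of_le hN₀ (hle.trans hN)
    let f := e₀.trans e.symm
    obtain ⟨a, ha⟩ := CurrentAlgebra.exists_invariantsAction_eq V p hp N₀
      (T.incl.comp f.toLieModuleHom)
    have h := hstable a _ (hle (f.symm ⟨t, ht⟩).2)
    rw [ha] at h
    have h' : (T.incl.comp f.toLieModuleHom) (f.symm ⟨t, ht⟩) = t :=
      congrArg Subtype.val (f.apply_symm_apply ⟨t, ht⟩)
    rwa [h'] at h
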